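/- For $n\ge 2$ let $\mathbb{R}^{3\times n}$ have standard basis $\{e_{i,j} : 0\le i\le 2,\ 0\le j\le n-1\}$, and let $Q_n\subset\mathbb{R}^{3\times n}$ be the Minkowski sum $$Q_n=\sum_{\substack{0\le i\le 1\\ 0\le j\le n-2}}\Delta_{i,j},\qquad \Delta_{i,j}=\operatorname{conv}\{e_{i,j},\,e_{i,j+1},\,e_{i+1,j},\,e_{i+1,j+1}\}.$$ Let $V_n$ be the number of vertices of the polytope $Q_n$, and let $$\alpha_2=\frac13\left(11+\sqrt[3]{\tfrac12\left(1825-3\sqrt{921}\right)}+\sqrt[3]{\tfrac12\left(1825+3\sqrt{921}\right)}\right).$$ Then $$\lim_{n\to\infty}\frac1n\ln V_n=\ln\alpha_2 .$$ Moreover, $\alpha_2$ is the largest real root of $x^3-11x^2+9x-2$, and $\alpha_2\approx 10.1311$ and $\ln\alpha_2\approx 2.3156$, each correct to four decimal places: $|\alpha_2-10.1311|<5\cdot 10^{-5}$ and $|\ln\alpha_2-2.3156|<5\cdot 10^{-5}$. -/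

import Mathlib

open scoped Pointwise

noncomputable section

namespace MaxPooling

/-- The standard basis vector `e_{i,j}` of the space `ℝ^{3 × n}`, for `0 ≤ i ≤ 2` and
`0 ≤ j ≤ n - 1`. -/
def e {n : ℕ} (i : Fin 3) (j : Fin n) : Fin 3 × Fin n → ℝ :=
  Pi.single (i, j) 1

/-- The simplex `Δ_{i,j} = conv {e_{i,j}, e_{i,j+1}, e_{i+1,j}, e_{i+1,j+1}}` in `ℝ^{3 × n}`,
for `0 ≤ i ≤ 1` and `0 ≤ j ≤ n - 2`. -/
def Delta {n : ℕ} (i : Fin 2) (j : Fin (n - 1)) : Set (Fin 3 × Fin n → ℝ) :=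
  have h : (j : ℕ) < n - 1 := j.isLt
  let j₀ : Fin n := ⟨j, by omega⟩
  let j₁ : Fin n := ⟨j + 1, by omega⟩
  convexHull ℝ {e i.castSucc j₀, e i.castSucc j₁, e i.succ j₀, e i.succ j₁}

/-- The polytope `Q_n`: the Minkowski sum of the `2 (n - 1)` simplices `Δ_{i,j}`. -/
def Q (n : ℕ) : Set (Fin 3 × Fin n → ℝ) :=
  ∑ i : Fin 2, ∑ j : Fin (n - 1), Delta i j

/-- The number `V_n` of vertices of `Q_n`. A vertex of a polytope is a point that is by itself the
face on which some linear functional attains its maximum, that is, an exposed point. -/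
def V (n : ℕ) : ℕ :=
  ((Q n).exposedPoints ℝ).ncard

/-- The real number
`α₂ = (11 + ∛((1825 - 3 √921) / 2) + ∛((1825 + 3 √921) / 2)) / 3`
(both numbers under the cube roots are positive). -/
def alpha2 : ℝ :=
  (1 / 3) * (11 + ((1 / 2) * (1825 - 3 * Real.sqrt 921)) ^ (1 / 3 : ℝ)
    + ((1 / 2) * (1825 + 3 * Real.sqrt 921)) ^ (1 / 3 : ℝ))

end MaxPooling

end

/-! A linear functional on ℝ^{3×n} is a matrix of weights. The vertices of Q_n correspond
bijectively to the choices of one corner in each 2×2 window for which some weights make every chosen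
corner the strict maximum of its window (`ncard_exposedPoints_sum_convexHull_range`).

Read from left to right, a choice is a word of n - 1 pairs of corners. When the columns of weights
are eliminated one by one, the possible last columns are cut out exactly by one of eleven order
conditions: `exists_step` shows that the condition is necessary, `exists_isArgmax_of_step` that
every column satisfying it extends to the left. So V_n counts the words accepted by a finite
automaton. Its transfer matrix has a positive eigenvector with eigenvalue α₂, hence V_n lies between
two positive multiples of α₂^(n-1). -/

namespace MaxPooling

/-! ### Windows, choices and the column automaton -/

/-- The four cells of a `2 × 2` window: top left, top right, bottom left, bottom right. -/
inductive Corner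
  | tl | tr | bl | br
  deriving DecidableEq

namespace Corner

instance : Nonempty Corner :=
  ⟨tl⟩

instance : Fintype Corner :=
  ⟨{tl, tr, bl, br}, fun c => by cases c <;> simp⟩

/-- The row offset of a corner, as a map from rows of windows to rows of cells. -/
def row : Corner → Fin 2 → Fin 3
  | tl, i => i.castSucc
  | tr, i => i.castSucc
  | bl, i => i.succ
  | br, i => i.succ

/-- The column offset of a corner, as a map from columns of windows to columns of cells. -/
def col {m : ℕ} : Corner → Fin m → Fin (m + 1)
  | tl, j => j.castSucc
  | tr, j => j.succ
  | bl, j => j.castSucc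
  | br, j => j.succ

/-- The entry at a corner of the window in row `i` between adjacent columns `a` and `b`. -/
def entry (a b : Fin 3 → ℝ) (i : Fin 2) : Corner → ℝ
  | tl => a i.castSucc
  | tr => b i.castSucc
  | bl => a i.succ
  | br => b i.succ

lemma forall_iff {p : Corner → Prop} : (∀ c, p c) ↔ p tl ∧ p tr ∧ p bl ∧ p br :=
  ⟨fun h => ⟨h _, h _, h _, h _⟩, fun ⟨h₁, h₂, h₃, h₄⟩ c => by cases c <;> assumption⟩

lemma sum_eq {M : Type*} [AddCommMonoid M] (f : Corner → M) :
    ∑ c, f c = f tl + (f tr + (f bl + f br)) := by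
  change ∑ c ∈ {tl, tr, bl, br}, f c = _
  simp [Finset.sum_insert]

end Corner

open Corner

/-- The choices `x` of a corner in the upper and in the lower window between adjacent columns `a`
and `b` are the strict maxima of these windows. -/
def IsArgmax (x : Corner × Corner) (a b : Fin 3 → ℝ) : Prop :=
  (∀ c, c ≠ x.1 → entry a b 0 c < entry a b 0 x.1) ∧
    ∀ c, c ≠ x.2 → entry a b 1 c < entry a b 1 x.2

/-- What the choices made so far imply about the last column. The letters say for the upper and
the lower window whether the maximum is in the left column (`l`), in the upper right (`u`) or the
lower right (`d`) corner; `lds` and `uls` carry an additional inequality that comes from further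
left. -/
inductive State
  | ll | lu | ld | lds | ul | uls | dl | uu | ud | du | dd

open State

/-- The inequalities between the entries of the last column that a state stands for. -/
def State.Holds : State → (Fin 3 → ℝ) → Prop
  | ll, _ => True
  | lu, b => b 2 < b 1
  | ld, b => b 1 < b 2
  | lds, b => b 0 < b 2 ∧ b 1 < b 2
  | ul, b => b 1 < b 0
  | uls, b => b 1 < b 0 ∧ b 2 < b 0
  | dl, b => b 0 < b 1
  | uu, b => b 1 < b 0 ∧ b 2 < b 1
  | ud, b => b 1 < b 0 ∧ b 1 < b 2
  | du, b => b 0 < b 1 ∧ b 2 < b 1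
  | dd, b => b 0 < b 1 ∧ b 1 < b 2

/-- The state after a further column of choices; `none` if the choices are contradictory. -/
def step : State → Corner × Corner → Option State
  | dl, (tl, _) | du, (tl, _) | dd, (tl, _) => none
  | ul, (bl, _) | uls, (bl, _) | uu, (bl, _) | ud, (bl, _) => none
  | ld, (_, tl) | lds, (_, tl) | ud, (_, tl) | dd, (_, tl) => none
  | lu, (_, bl) | uu, (_, bl) | du, (_, bl) => none
  -- The windows share the middle row, and these choices order its two entries in opposite ways.
  | _, (bl, tr) | _, (br, tl) => none
  -- Here the extra inequality between the outer entries closes a cycle through the middle entry of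
  -- the new column.
  | lds, (tl, tr) | uls, (br, bl) => none
  | lds, (tl, br) | _, (bl, br) => some lds
  | uls, (tr, bl) | _, (tr, tl) => some uls
  | _, (tl, tl) | _, (tl, bl) | _, (bl, tl) | _, (bl, bl) => some ll
  | _, (tl, tr) => some lu
  | _, (tl, br) => some ld
  | _, (tr, bl) => some ul
  | _, (br, bl) => some dl
  | _, (tr, tr) => some uu
  | _, (tr, br) => some ud
  | _, (br, tr) => some du
  | _, (br, br) => some dd

lemma exists_step {s : State} {x : Corner × Corner} {a b : Fin 3 → ℝ} (hs : s.Holds a)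
    (hx : IsArgmax x a b) : ∃ t, step s x = some t ∧ t.Holds b := by
  obtain ⟨t, c⟩ := x
  cases t <;> cases c <;>
    simp [IsArgmax, Corner.forall_iff, entry] at hx <;>
    cases s <;> simp [step, State.Holds] at hs ⊢ <;>
    (try refine ⟨?_, ?_⟩) <;> linarith

-- No information is lost in a step: the condition `t` is the exact projection of the constraints to
-- the new column.
set_option maxHeartbeats 2000000 in
lemma exists_isArgmax_of_step {s t : State} {x : Corner × Corner} {b : Fin 3 → ℝ}
    (hst : step s x = some t) (ht : t.Holds b) : ∃ a, s.Holds a ∧ IsArgmax x a b := by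
  -- Entries of `a` above `M` beat all of `b`, and entries below `-M` lose to all of `b`.
  obtain ⟨M, hM⟩ : ∃ M, ∀ i, |b i| < M :=
    ⟨|b 0| + |b 1| + |b 2| + 1, fun i => by
      fin_cases i <;> simp <;> linarith [abs_nonneg (b 0), abs_nonneg (b 1), abs_nonneg (b 2)]⟩
  have h0 := abs_lt.1 (hM 0)
  have h1 := abs_lt.1 (hM 1)
  have h2 := abs_lt.1 (hM 2)
  clear hM
  -- For the targets `lds` and `uls`, entries of `a` may have to lie between entries of `b`; two
  -- ordered values leave room for the inequalities of `s`.
  have mid : ∀ {x y z : ℝ}, x < z → y < z → ∃ p q, x < p ∧ y < p ∧ p < q ∧ q < z := by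
    intro x y z hx hy
    obtain ⟨p, hp, hpz⟩ := exists_between (max_lt hx hy)
    obtain ⟨q, hq, hqz⟩ := exists_between hpz
    exact ⟨p, q, (max_lt_iff.1 hp).1, (max_lt_iff.1 hp).2, hq, hqz⟩
  suffices ∃ a₀ a₁ a₂ : ℝ, s.Holds ![a₀, a₁, a₂] ∧ IsArgmax x ![a₀, a₁, a₂] b by
    obtain ⟨a₀, a₁, a₂, h⟩ := this
    exact ⟨_, h⟩
  obtain ⟨y, z⟩ := x
  cases y <;> cases z
  case tl.tl =>
    cases s <;> simp [step] at hst <;> subst hst <;>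
      simp [State.Holds] at ht <;>
      first
        | (refine ⟨M + 2, M + 1, M, ?_⟩
           simp [State.Holds, IsArgmax, Corner.forall_iff, entry]
           and_intros <;> linarith)
  case tl.tr =>
    cases s <;> simp [step] at hst <;> subst hst <;>
      simp [State.Holds] at ht <;>
      first
        | (refine ⟨M, -M - 2, -M - 3, ?_⟩
           simp [State.Holds, IsArgmax, Corner.forall_iff, entry]
           and_intros <;> linarith)
        | (refine ⟨M, -M - 3, -M - 2, ?_⟩
           simp [State.Holds, IsArgmax, Corner.forall_iff, entry]
           and_intros <;> linarith)
  case tl.bl =>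
    cases s <;> simp [step] at hst <;> subst hst <;>
      simp [State.Holds] at ht <;>
      first
        | (refine ⟨M, -M - 3, M + 1, ?_⟩
           simp [State.Holds, IsArgmax, Corner.forall_iff, entry]
           and_intros <;> linarith)
        | (refine ⟨M + 1, -M - 3, M, ?_⟩
           simp [State.Holds, IsArgmax, Corner.forall_iff, entry]
           and_intros <;> linarith)
  case tl.br =>
    cases s <;> simp [step] at hst <;> subst hst <;>
      simp [State.Holds] at ht <;>
      first
        | (refine ⟨M, -M - 2, -M - 3, ?_⟩
           simp [State.Holds, IsArgmax, Corner.forall_iff, entry]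
           and_intros <;> linarith)
        | (refine ⟨M, -M - 3, -M - 2, ?_⟩
           simp [State.Holds, IsArgmax, Corner.forall_iff, entry]
           and_intros <;> linarith)
        | (obtain ⟨p, q, _, _, _, _⟩ := mid ht.1 ht.2
           refine ⟨p, -M - 3, q, ?_⟩
           simp [State.Holds, IsArgmax, Corner.forall_iff, entry]
           and_intros <;> linarith)
  case tr.tl =>
    cases s <;> simp [step] at hst <;> subst hst <;>
      simp [State.Holds] at ht <;>
      first
        | (obtain ⟨p, q, _, _, _, _⟩ := mid ht.1 ht.2
           refine ⟨q, p, -M, ?_⟩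
           simp [State.Holds, IsArgmax, Corner.forall_iff, entry]
           and_intros <;> linarith)
        | (obtain ⟨p, q, _, _, _, _⟩ := mid ht.1 ht.2
           refine ⟨-M, p, -M, ?_⟩
           simp [State.Holds, IsArgmax, Corner.forall_iff, entry]
           and_intros <;> linarith)
  case tr.tr =>
    cases s <;> simp [step] at hst <;> subst hst <;>
      simp [State.Holds] at ht <;>
      first
        | (refine ⟨-M - 1, -M - 2, -M - 3, ?_⟩
           simp [State.Holds, IsArgmax, Corner.forall_iff, entry]
           and_intros <;> linarith)
        | (refine ⟨-M - 3, -M - 2, -M - 1, ?_⟩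
           simp [State.Holds, IsArgmax, Corner.forall_iff, entry]
           and_intros <;> linarith)
        | (refine ⟨-M - 2, -M - 3, -M - 1, ?_⟩
           simp [State.Holds, IsArgmax, Corner.forall_iff, entry]
           and_intros <;> linarith)
        | (refine ⟨-M - 2, -M - 1, -M - 3, ?_⟩
           simp [State.Holds, IsArgmax, Corner.forall_iff, entry]
           and_intros <;> linarith)
  case tr.bl =>
    cases s <;> simp [step] at hst <;> subst hst <;>
      simp [State.Holds] at ht <;>
      first
        | (refine ⟨-M - 2, -M - 3, M, ?_⟩
           simp [State.Holds, IsArgmax, Corner.forall_iff, entry]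
           and_intros <;> linarith)
        | (refine ⟨-M - 3, -M - 2, M, ?_⟩
           simp [State.Holds, IsArgmax, Corner.forall_iff, entry]
           and_intros <;> linarith)
        | (obtain ⟨p, q, _, _, _, _⟩ := mid ht.1 ht.2
           refine ⟨q, -M, p, ?_⟩
           simp [State.Holds, IsArgmax, Corner.forall_iff, entry]
           and_intros <;> linarith)
  case tr.br =>
    cases s <;> simp [step] at hst <;> subst hst <;>
      simp [State.Holds] at ht <;>
      first
        | (refine ⟨-M - 1, -M - 2, -M - 3, ?_⟩
           simp [State.Holds, IsArgmax, Corner.forall_iff, entry]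
           and_intros <;> linarith)
        | (refine ⟨-M - 3, -M - 2, -M - 1, ?_⟩
           simp [State.Holds, IsArgmax, Corner.forall_iff, entry]
           and_intros <;> linarith)
        | (refine ⟨-M - 2, -M - 3, -M - 1, ?_⟩
           simp [State.Holds, IsArgmax, Corner.forall_iff, entry]
           and_intros <;> linarith)
        | (refine ⟨-M - 2, -M - 1, -M - 3, ?_⟩
           simp [State.Holds, IsArgmax, Corner.forall_iff, entry]
           and_intros <;> linarith)
  case bl.tl =>
    cases s <;> simp [step] at hst <;> subst hst <;>
      simp [State.Holds] at ht <;>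
      first
        | (refine ⟨-M - 2, M, -M - 3, ?_⟩
           simp [State.Holds, IsArgmax, Corner.forall_iff, entry]
           and_intros <;> linarith)
  case bl.bl =>
    cases s <;> simp [step] at hst <;> subst hst <;>
      simp [State.Holds] at ht <;>
      first
        | (refine ⟨M, M + 1, M + 2, ?_⟩
           simp [State.Holds, IsArgmax, Corner.forall_iff, entry]
           and_intros <;> linarith)
  case bl.br =>
    cases s <;> simp [step] at hst <;> subst hst <;>
      simp [State.Holds] at ht <;>
      first
        | (obtain ⟨p, q, _, _, _, _⟩ := mid ht.1 ht.2
           refine ⟨-M, p, q, ?_⟩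
           simp [State.Holds, IsArgmax, Corner.forall_iff, entry]
           and_intros <;> linarith)
        | (obtain ⟨p, q, _, _, _, _⟩ := mid ht.1 ht.2
           refine ⟨-M, p, -M, ?_⟩
           simp [State.Holds, IsArgmax, Corner.forall_iff, entry]
           and_intros <;> linarith)
  case br.tr =>
    cases s <;> simp [step] at hst <;> subst hst <;>
      simp [State.Holds] at ht <;>
      first
        | (refine ⟨-M - 1, -M - 2, -M - 3, ?_⟩
           simp [State.Holds, IsArgmax, Corner.forall_iff, entry]
           and_intros <;> linarith)
        | (refine ⟨-M - 3, -M - 2, -M - 1, ?_⟩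
           simp [State.Holds, IsArgmax, Corner.forall_iff, entry]
           and_intros <;> linarith)
        | (refine ⟨-M - 2, -M - 3, -M - 1, ?_⟩
           simp [State.Holds, IsArgmax, Corner.forall_iff, entry]
           and_intros <;> linarith)
        | (refine ⟨-M - 2, -M - 1, -M - 3, ?_⟩
           simp [State.Holds, IsArgmax, Corner.forall_iff, entry]
           and_intros <;> linarith)
  case br.bl =>
    cases s <;> simp [step] at hst <;> subst hst <;>
      simp [State.Holds] at ht <;>
      first
        | (refine ⟨-M - 2, -M - 3, M, ?_⟩
           simp [State.Holds, IsArgmax, Corner.forall_iff, entry]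
           and_intros <;> linarith)
        | (refine ⟨-M - 3, -M - 2, M, ?_⟩
           simp [State.Holds, IsArgmax, Corner.forall_iff, entry]
           and_intros <;> linarith)
  case br.br =>
    cases s <;> simp [step] at hst <;> subst hst <;>
      simp [State.Holds] at ht <;>
      first
        | (refine ⟨-M - 1, -M - 2, -M - 3, ?_⟩
           simp [State.Holds, IsArgmax, Corner.forall_iff, entry]
           and_intros <;> linarith)
        | (refine ⟨-M - 3, -M - 2, -M - 1, ?_⟩
           simp [State.Holds, IsArgmax, Corner.forall_iff, entry]
           and_intros <;> linarith)
        | (refine ⟨-M - 2, -M - 3, -M - 1, ?_⟩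
           simp [State.Holds, IsArgmax, Corner.forall_iff, entry]
           and_intros <;> linarith)
        | (refine ⟨-M - 2, -M - 1, -M - 3, ?_⟩
           simp [State.Holds, IsArgmax, Corner.forall_iff, entry]
           and_intros <;> linarith)
  all_goals cases s <;> simp [step] at hst

open Corner State

/-- The automaton `step` reads the whole word from the given state. -/
def Accepts : ∀ {m : ℕ}, State → (Fin m → Corner × Corner) → Prop
  | 0, _, _ => True
  | _ + 1, s, x => ∃ t, step s (x 0) = some t ∧ Accepts t (Fin.tail x)

lemma accepts_iff {m : ℕ} {s : State} {x : Fin m → Corner × Corner} :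
    Accepts s x ↔ ∃ w : Fin (m + 1) → Fin 3 → ℝ, s.Holds (w 0) ∧
      ∀ j, IsArgmax (x j) (w j.castSucc) (w j.succ) := by
  induction m generalizing s with
  | zero =>
    refine ⟨fun _ => ?_, fun _ => trivial⟩
    suffices ∃ a, s.Holds a by
      obtain ⟨a, ha⟩ := this
      exact ⟨fun _ => a, ha, fun j => j.elim0⟩
    -- The letter `(tr, tr)` is allowed from every state, so pulling back along it shows that every
    -- state is satisfiable.
    have h : step s (tr, tr) = some uu := by cases s <;> rfl
    obtain ⟨a, ha, -⟩ := exists_isArgmax_of_step h (b := ![2, 1, 0]) (by simp [State.Holds])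
    exact ⟨a, ha⟩
  | succ m ih =>
    constructor
    · rintro ⟨t, hst, ht⟩
      obtain ⟨w, hw, h⟩ := ih.1 ht
      obtain ⟨a, ha, hx⟩ := exists_isArgmax_of_step hst hw
      refine ⟨Fin.cons a w, ha, fun j => ?_⟩
      refine Fin.cases ?_ (fun j => ?_) j
      · simpa using hx
      · simpa [Fin.tail, ← Fin.succ_castSucc] using h j
    · rintro ⟨w, hw, h⟩
      obtain ⟨t, hst, ht⟩ := exists_step hw (h 0)
      refine ⟨t, hst, ih.2 ⟨Fin.tail w, ht, fun j => ?_⟩⟩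
      simpa [Fin.tail, ← Fin.succ_castSucc] using h j.succ

/-! ### Counting by the transfer matrix -/

/-- The number of words of a given length that are accepted from a given state. -/
noncomputable def acceptedCount (m : ℕ) (s : State) : ℕ :=
  Nat.card {x : Fin m → Corner × Corner // Accepts s x}

lemma acceptedCount_zero (s : State) : acceptedCount 0 s = 1 := by
  simp [acceptedCount, Accepts]

lemma acceptedCount_succ (m : ℕ) (s : State) :
    acceptedCount (m + 1) s = ∑ x, (step s x).elim 0 (acceptedCount m) := by
  have e : {x : Fin (m + 1) → Corner × Corner // Accepts s x} ≃
      Σ x₀ : Corner × Corner, {x : Fin m → Corner × Corner //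
        ∃ t, step s x₀ = some t ∧ Accepts t x} :=
    { toFun := fun x => ⟨x.1 0, Fin.tail x.1, x.2⟩
      invFun := fun x => ⟨Fin.cons x.1 x.2.1, by simpa [Accepts] using x.2.2⟩
      left_inv := fun x => by simp
      right_inv := fun _ => rfl }
  rw [acceptedCount, Nat.card_congr e, Nat.card_sigma]
  refine Finset.sum_congr rfl fun x _ => ?_
  cases h : step s x with
  | none => simp
  | some t => simp [acceptedCount]

/-- A positive eigenvector, for the eigenvalue `α`, of the transfer matrix of the automaton. -/
noncomputable def eigenvector (α : ℝ) : State → ℝ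
  | ll => (α ^ 2 - 5 * α + 3) / 4
  | lu | lds | uls | dl => α - 1
  | ld | ul => α
  | uu | dd => (α ^ 2 - 5 * α + 3) / 8
  | ud => (α ^ 2 - 5 * α + 3) / 8 + 1
  | du => (α ^ 2 - 5 * α + 3) / 8 - 1

/-- The rows of `ll`, `uu`, `dd`, `ud` and `du` reduce to multiples of the cubic; the other rows are
identities in `α`. -/
lemma sum_eigenvector {α : ℝ} (hα : α ^ 3 - 11 * α ^ 2 + 9 * α - 2 = 0) (s : State) :
    ∑ x, (step s x).elim 0 (eigenvector α) = α * eigenvector α s := by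
  rw [Fintype.sum_prod_type]
  cases s <;> simp [Corner.sum_eq, step, eigenvector] <;> linarith

lemma acceptedCount_le {α : ℝ} (hα : α ^ 3 - 11 * α ^ 2 + 9 * α - 2 = 0)
    (h1 : ∀ s, 1 ≤ eigenvector α s) (m : ℕ) (s : State) :
    (acceptedCount m s : ℝ) ≤ α ^ m * eigenvector α s := by
  induction m generalizing s with
  | zero => simpa [acceptedCount_zero] using h1 s
  | succ m ih =>
    rw [acceptedCount_succ, pow_succ, mul_assoc, ← sum_eigenvector hα, Finset.mul_sum,
      Nat.cast_sum]
    refine Finset.sum_le_sum fun x _ => ?_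
    cases step s x with
    | none => simp
    | some t => exact ih t

lemma le_acceptedCount {α K : ℝ} (hα : α ^ 3 - 11 * α ^ 2 + 9 * α - 2 = 0)
    (hK : ∀ s, eigenvector α s ≤ K) (m : ℕ) (s : State) :
    α ^ m * eigenvector α s ≤ K * acceptedCount m s := by
  induction m generalizing s with
  | zero => simpa [acceptedCount_zero] using hK s
  | succ m ih =>
    rw [acceptedCount_succ, pow_succ, mul_assoc, ← sum_eigenvector hα, Finset.mul_sum,
      Nat.cast_sum, Finset.mul_sum]
    refine Finset.sum_le_sum fun x _ => ?_
    cases step s x with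
    | none => simp
    | some t => exact ih t

/-! ### The root α₂ and its numerical value -/

/-- Cardano: with `u`, `v` the two cube roots, u v = 94 and u³ + v³ = 1825, so t = u + v = 3 α₂ - 11
solves t³ = 282 t + 1825. -/
lemma alpha2_root_and_gt :
    alpha2 ^ 3 - 11 * alpha2 ^ 2 + 9 * alpha2 - 2 = 0 ∧ 8 < alpha2 := by
  have hs : Real.sqrt 921 ^ 2 = 921 := Real.sq_sqrt (by norm_num)
  have hs0 : 0 ≤ Real.sqrt 921 := Real.sqrt_nonneg _
  have hs1 : Real.sqrt 921 < 31 := by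
    rw [Real.sqrt_lt' (by norm_num)]; norm_num
  have cube : ∀ y : ℝ, 0 ≤ y → (y ^ (1 / 3 : ℝ)) ^ 3 = y := fun y hy => by
    rw [← Real.rpow_natCast, ← Real.rpow_mul hy]; norm_num
  unfold alpha2
  set s := Real.sqrt 921
  set p : ℝ := (1 / 2) * (1825 - 3 * s)
  set q : ℝ := (1 / 2) * (1825 + 3 * s)
  have hp : 0 ≤ p := by simp only [p]; linarith
  have hq : 0 ≤ q := by simp only [q]; linarith
  have hu3 := cube p hp
  have hv3 := cube q hq
  have huv : p ^ (1 / 3 : ℝ) * q ^ (1 / 3 : ℝ) = 94 := by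
    rw [← Real.mul_rpow hp hq, show p * q = 94 ^ (3 : ℝ) by
      norm_num [p, q]; nlinarith, ← Real.rpow_mul (by norm_num)]
    norm_num
  have hu0 : 0 ≤ p ^ (1 / 3 : ℝ) := Real.rpow_nonneg hp _
  have hv0 : 0 ≤ q ^ (1 / 3 : ℝ) := Real.rpow_nonneg hq _
  generalize p ^ (1 / 3 : ℝ) = u at *
  generalize q ^ (1 / 3 : ℝ) = v at *
  have hsum : u ^ 3 + v ^ 3 = 1825 := by rw [hu3, hv3]; simp only [p, q]; ring
  constructor
  · linear_combination (1 / 27) * hsum + (1 / 9) * (u + v) * huv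
  -- By AM-GM (u + v)² ≥ 4 · 94 > 13².
  · nlinarith [sq_nonneg (u - v), sq_nonneg (u + v - 13)]

lemma cubic_strictMonoOn :
    StrictMonoOn (fun x : ℝ => x ^ 3 - 11 * x ^ 2 + 9 * x - 2) (Set.Ici 8) := by
  intro x (hx : 8 ≤ x) y (hy : 8 ≤ y) hxy
  -- The divided difference of the cubic.
  have : 0 < x ^ 2 + x * y + y ^ 2 - 11 * (x + y) + 9 := by
    nlinarith [mul_nonneg (sub_nonneg.2 hx) (sub_nonneg.2 hy)]
  change x ^ 3 - 11 * x ^ 2 + 9 * x - 2 < y ^ 3 - 11 * y ^ 2 + 9 * y - 2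
  linear_combination (mul_pos (sub_pos.2 hxy) this)

lemma alpha2_bounds : 10.13113 < alpha2 ∧ alpha2 < 10.13114 := by
  obtain ⟨h, h8⟩ := alpha2_root_and_gt
  constructor
  · refine (cubic_strictMonoOn.lt_iff_lt (by norm_num) h8.le).1 ?_
    simp only [h]
    norm_num
  · refine (cubic_strictMonoOn.lt_iff_lt h8.le (by norm_num)).1 ?_
    simp only [h]
    norm_num

lemma isGreatest_alpha2 :
    IsGreatest {x : ℝ | x ^ 3 - 11 * x ^ 2 + 9 * x - 2 = 0} alpha2 := by
  obtain ⟨h, h8⟩ := alpha2_root_and_gt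
  refine ⟨h, fun x (hx : _ = _) => ?_⟩
  by_contra! hc
  have := cubic_strictMonoOn h8.le (h8.le.trans hc.le) hc
  simp only [h, hx, lt_irrefl] at this

lemma log_alpha2_bounds : |Real.log alpha2 - 2.3156| < 0.00005 := by
  obtain ⟨h1, h2⟩ := alpha2_bounds
  have h2l := Real.log_two_gt_d9
  have h2u := Real.log_two_lt_d9
  -- Since α₂³ is close to 2¹⁰, two terms of the logarithm series suffice.
  have key : ∀ q : ℝ, 0 < q → 3 * Real.log q = 10 * Real.log 2 + Real.log (1 - (1 - q ^ 3 / 1024)) :=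
    fun q hq => by
      rw [sub_sub_cancel, Real.log_div (by positivity) (by norm_num), Real.log_pow,
        show (1024 : ℝ) = 2 ^ 10 by norm_num, Real.log_pow]
      push_cast
      ring
  have hl := Real.log_lt_log (by norm_num) h1
  have hu := Real.log_lt_log (by linarith) h2
  have kl := key 10.13113 (by norm_num)
  have ku := key 10.13114 (by norm_num)
  have el := Real.abs_log_sub_add_sum_range_le (x := 1 - 10.13113 ^ 3 / 1024)
    (by rw [abs_lt]; norm_num) 2
  have eu := Real.abs_log_sub_add_sum_range_le (x := 1 - 10.13114 ^ 3 / 1024)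
    (by rw [abs_lt]; norm_num) 2
  rw [abs_of_neg (by norm_num : (1 - 10.13113 ^ 3 / 1024 : ℝ) < 0), abs_le] at el
  rw [abs_of_neg (by norm_num : (1 - 10.13114 ^ 3 / 1024 : ℝ) < 0), abs_le] at eu
  generalize Real.log (1 - (1 - 10.13113 ^ 3 / 1024)) = A at *
  generalize Real.log (1 - (1 - 10.13114 ^ 3 / 1024)) = B at *
  norm_num [Finset.sum_range_succ] at el eu
  rw [abs_lt]
  constructor <;> linarith

/-! ### Vertices of a Minkowski sum -/

/-- If a linear functional is smaller on `s` than at `v`, except at `v` itself, then the same holds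
on `convexHull s`. -/
lemma le_and_eq_of_mem_convexHull {E : Type*} [AddCommGroup E] [Module ℝ E] (l : E →ₗ[ℝ] ℝ)
    {s : Set E} {v : E} (h : ∀ y ∈ s, y ≠ v → l y < l v) {y : E} (hy : y ∈ convexHull ℝ s) :
    l y ≤ l v ∧ (l v ≤ l y → y = v) := by
  suffices convexHull ℝ s ⊆ {y | l y ≤ l v ∧ (l v ≤ l y → y = v)} from this hy
  refine convexHull_min (fun y hy => ?_) ?_
  · by_cases hv : y = v
    · simp [hv]
    · exact ⟨(h y hy hv).le, fun h' => absurd (h y hy hv) h'.not_gt⟩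
  · rw [convex_iff_forall_pos]
    rintro x ⟨hx, hx'⟩ y ⟨hy, hy'⟩ a b ha hb hab
    have e : l (a • x + b • y) = a * l x + b * l y := by simp
    have hsum : a * l v + b * l v = l v := by rw [← add_mul, hab, one_mul]
    have h1 := mul_le_mul_of_nonneg_left hx ha.le
    have h2 := mul_le_mul_of_nonneg_left hy hb.le
    refine ⟨by rw [e]; linarith, fun h => ?_⟩
    rw [e] at h
    rw [hx' (le_of_mul_le_mul_left (by linarith) ha),
      hy' (le_of_mul_le_mul_left (by linarith) hb), ← add_smul, hab, one_smul]

section Minkowski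

variable {ι σ E : Type*} [Fintype ι]
  [AddCommGroup E] [Module ℝ E] [TopologicalSpace E]

/-- The choice `g` of one point from each of the families `p i` consists of the strict maxima of
some continuous linear functional. -/
def IsStrictMaxChoice (p : ι → σ → E) (g : ι → σ) : Prop :=
  ∃ l : StrongDual ℝ E, ∀ i c, c ≠ g i → l (p i c) < l (p i (g i))

lemma le_and_eq_of_mem_sum {p : ι → σ → E} {g : ι → σ} {l : StrongDual ℝ E}
    (hl : ∀ i c, c ≠ g i → l (p i c) < l (p i (g i))) {y : ι → E}
    (hy : ∀ i, y i ∈ convexHull ℝ (Set.range (p i))) :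
    l (∑ i, y i) ≤ l (∑ i, p i (g i)) ∧
      (l (∑ i, p i (g i)) ≤ l (∑ i, y i) → ∀ i, y i = p i (g i)) := by
  have key i := le_and_eq_of_mem_convexHull l.toLinearMap (s := Set.range (p i)) (v := p i (g i))
    (by
      rintro _ ⟨c, rfl⟩ hc
      exact hl i c fun h => hc (by rw [h])) (hy i)
  simp only [map_sum]
  refine ⟨Finset.sum_le_sum fun i _ => (key i).1, fun h i => (key i).2 ?_⟩
  by_contra! hlt
  exact (Finset.sum_lt_sum (fun i _ => (key i).1) ⟨i, Finset.mem_univ i, hlt⟩).not_ge h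

lemma exposedPoints_sum_convexHull_range [Nonempty σ] [Finite σ] {p : ι → σ → E} (hp : ∀ i, Function.Injective (p i)) :
    (∑ i, convexHull ℝ (Set.range (p i))).exposedPoints ℝ =
      (fun g : ι → σ => ∑ i, p i (g i)) '' {g | IsStrictMaxChoice p g} := by
  have hmem (g : ι → σ) : ∑ i, p i (g i) ∈ ∑ i, convexHull ℝ (Set.range (p i)) :=
    (Set.mem_fintype_sum _ _).2 ⟨fun i => p i (g i),
      fun i => subset_convexHull ℝ _ (Set.mem_range_self _), rfl⟩
  ext x
  constructor
  · rintro ⟨hx, l, hl⟩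
    obtain ⟨y, hy, rfl⟩ := (Set.mem_fintype_sum _ _).1 hx
    choose g hg using fun i => Finite.exists_max fun c => l (p i c)
    have hle i : l (y i) ≤ l (p i (g i)) := by
      suffices convexHull ℝ (Set.range (p i)) ⊆ {z | l z ≤ l (p i (g i))} from this (hy i)
      refine convexHull_min ?_ (convex_halfSpace_le l.toLinearMap.isLinear _)
      rintro _ ⟨c, rfl⟩
      exact hg i c
    have heq : ∑ i, p i (g i) = ∑ i, y i := by
      refine (hl _ (hmem g)).2 ?_
      simpa only [map_sum] using Finset.sum_le_sum fun i _ => hle i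
    refine ⟨g, ⟨l, fun i c hc => lt_of_le_of_ne (hg i c) fun h => hc ?_⟩, heq⟩
    classical
    -- A tie in summand `i` could be swapped in, giving a second maximizer of `l` and contradicting
    -- exposedness.
    have hsum : ∑ j, p j (Function.update g i c j) =
        ∑ j, p j (g j) + (p i c - p i (g i)) := by
      rw [← Finset.add_sum_erase _ _ (Finset.mem_univ i),
        ← Finset.add_sum_erase _ (fun j => p j (g j)) (Finset.mem_univ i),
        Function.update_self, Finset.sum_congr rfl fun j hj => by
          rw [Function.update_of_ne (Finset.ne_of_mem_erase hj)]]
      abel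
    have := (hl _ (hmem (Function.update g i c))).2 (by
      rw [hsum, heq, map_add, map_sub, h, sub_self, add_zero])
    rw [this, heq, left_eq_add, sub_eq_zero] at hsum
    exact hp i hsum
  · rintro ⟨g, ⟨l, hl⟩, rfl⟩
    refine ⟨hmem g, l, fun z hz => ?_⟩
    obtain ⟨y, hy, rfl⟩ := (Set.mem_fintype_sum _ _).1 hz
    have := le_and_eq_of_mem_sum hl hy
    exact ⟨this.1, fun h => Finset.sum_congr rfl fun i _ => this.2 h i⟩

lemma injOn_sum_isStrictMaxChoice {p : ι → σ → E} (hp : ∀ i, Function.Injective (p i)) :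
    Set.InjOn (fun g : ι → σ => ∑ i, p i (g i)) {g | IsStrictMaxChoice p g} := by
  rintro g ⟨l, hl⟩ g' - h
  have := le_and_eq_of_mem_sum hl (y := fun i => p i (g' i))
    fun i => subset_convexHull ℝ _ (Set.mem_range_self _)
  exact funext fun i => (hp i (this.2 (congrArg l h).le i)).symm

lemma ncard_exposedPoints_sum_convexHull_range [Nonempty σ] [Finite σ] {p : ι → σ → E}
    (hp : ∀ i, Function.Injective (p i)) :
    ((∑ i, convexHull ℝ (Set.range (p i))).exposedPoints ℝ).ncard =
      Nat.card {g : ι → σ // IsStrictMaxChoice p g} := by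
  rw [exposedPoints_sum_convexHull_range hp, (injOn_sum_isStrictMaxChoice hp).ncard_image]
  rfl

end Minkowski

/-! ### From Q_n to accepted words -/

lemma e_injective {n : ℕ} {i i' : Fin 3} {j j' : Fin n} (h : e i j = e i' j') :
    i = i' ∧ j = j' := by
  by_contra hne
  have := congrFun h (i, j)
  rw [e, e, Pi.single_eq_same, Pi.single_eq_of_ne (by simpa using hne)] at this
  exact one_ne_zero this

/-- The vertices of the simplex `Δ_{i,j}`. -/
def windowVertex {m : ℕ} (q : Fin 2 × Fin m) (c : Corner) : Fin 3 × Fin (m + 1) → ℝ :=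
  e (c.row q.1) (c.col q.2)

lemma windowVertex_injective {m : ℕ} (q : Fin 2 × Fin m) :
    Function.Injective (windowVertex q) := by
  intro c c' h
  have := e_injective h
  cases c <;> cases c' <;> simp [row, col, Fin.ext_iff] at this <;> rfl

lemma Delta_eq {m : ℕ} (i : Fin 2) (j : Fin m) :
    Delta (n := m + 1) i j = convexHull ℝ (Set.range (windowVertex (i, j))) := by
  have : Set.range (windowVertex (i, j)) = {e i.castSucc j.castSucc, e i.castSucc j.succ,
      e i.succ j.castSucc, e i.succ j.succ} := by
    ext x
    simp only [Set.mem_range, Set.mem_insert_iff, Set.mem_singleton_iff]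
    constructor
    · rintro ⟨c, rfl⟩
      cases c <;> simp [windowVertex, row, col]
    · rintro (rfl | rfl | rfl | rfl)
      exacts [⟨tl, rfl⟩, ⟨tr, rfl⟩, ⟨bl, rfl⟩, ⟨br, rfl⟩]
  rw [this]
  rfl

lemma Q_eq (m : ℕ) : Q (m + 1) = ∑ q, convexHull ℝ (Set.range (windowVertex (m := m) q)) := by
  rw [Fintype.sum_prod_type]
  exact Finset.sum_congr rfl fun i _ => Finset.sum_congr rfl fun j _ => Delta_eq i j

/-- Functionals are the weight matrices of `accepts_iff`; the start state `ll` leaves the first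
column free. -/
lemma isStrictMaxChoice_windowVertex_iff {m : ℕ} {g : Fin 2 × Fin m → Corner} :
    IsStrictMaxChoice windowVertex g ↔ Accepts ll fun j => (g (0, j), g (1, j)) := by
  have hentry (w : Fin (m + 1) → Fin 3 → ℝ) (i : Fin 2) (j : Fin m) (c : Corner) :
      entry (w j.castSucc) (w j.succ) i c = w (c.col j) (c.row i) := by
    cases c <;> rfl
  have hiff (w : Fin (m + 1) → Fin 3 → ℝ) :
      (∀ j, IsArgmax (g (0, j), g (1, j)) (w j.castSucc) (w j.succ)) ↔
        ∀ (q : Fin 2 × Fin m) (c : Corner), c ≠ g q →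
          w (c.col q.2) (c.row q.1) < w ((g q).col q.2) ((g q).row q.1) := by
    simp only [IsArgmax, hentry, Prod.forall, Fin.forall_fin_two, ← forall_and]
  rw [accepts_iff]
  simp only [State.Holds, true_and, hiff]
  constructor
  · rintro ⟨l, hl⟩
    exact ⟨fun j i => l (e i j), hl⟩
  · rintro ⟨w, hw⟩
    refine ⟨∑ q : Fin 3 × Fin (m + 1), w q.2 q.1 • ContinuousLinearMap.proj q, ?_⟩
    simpa [windowVertex, e, Pi.single_apply, sum_apply] using hw

lemma V_succ (m : ℕ) : V (m + 1) = acceptedCount m ll := by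
  rw [V, Q_eq, ncard_exposedPoints_sum_convexHull_range windowVertex_injective, acceptedCount]
  let f : (Fin 2 × Fin m → Corner) ≃ (Fin m → Corner × Corner) :=
    { toFun := fun g j => (g (0, j), g (1, j))
      invFun := fun x q => if q.1 = 0 then (x q.2).1 else (x q.2).2
      left_inv := fun g => by
        ext ⟨i, j⟩
        fin_cases i <;> simp
      right_inv := fun x => by simp }
  exact Nat.card_congr (f.subtypeEquiv fun g => isStrictMaxChoice_windowVertex_iff)

/-! ### The growth rate -/

open Filter Topology in
lemma tendsto_log_div_of_pow_bounds {u : ℕ → ℝ} {α c C : ℝ} (hα : 0 < α) (hc : 0 < c)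
    (hlow : ∀ m, c * α ^ m ≤ u m) (hup : ∀ m, u m ≤ C * α ^ m) :
    Tendsto (fun m : ℕ => 1 / ((m + 1 : ℕ) : ℝ) * Real.log (u m)) atTop (𝓝 (Real.log α)) := by
  have hC : 0 < C := hc.trans_le (by simpa using (hlow 0).trans (hup 0))
  have hlim (K : ℝ) : Tendsto (fun m : ℕ => 1 / ((m + 1 : ℕ) : ℝ) * (K + m * Real.log α)) atTop
      (𝓝 (Real.log α)) := by
    have h := (tendsto_one_div_add_atTop_nhds_zero_nat (𝕜 := ℝ)).mul_const (K - Real.log α)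
    have h' := h.add_const (Real.log α)
    rw [zero_mul, zero_add] at h'
    refine h'.congr fun m => ?_
    have : (m : ℝ) + 1 ≠ 0 := by positivity
    push_cast
    field_simp
    ring
  have hlog {K : ℝ} (hK : 0 < K) (m : ℕ) :
      Real.log (K * α ^ m) = Real.log K + m * Real.log α := by
    rw [Real.log_mul hK.ne' (by positivity), Real.log_pow]
  refine tendsto_of_tendsto_of_tendsto_of_le_of_le (hlim (Real.log c)) (hlim (Real.log C))
    (fun m => ?_) (fun m => ?_)
  · dsimp only
    rw [← hlog hc]
    gcongr
    exact hlow m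
  · dsimp only
    rw [← hlog hC]
    have : 0 < u m := lt_of_lt_of_le (by positivity) (hlow m)
    gcongr
    exact hup m

lemma eigenvector_alpha2_mem_Icc (s : State) : eigenvector alpha2 s ∈ Set.Icc 1 20 := by
  obtain ⟨h1, h2⟩ := alpha2_bounds
  cases s <;> simp only [eigenvector, Set.mem_Icc] <;> constructor <;> nlinarith

end MaxPooling

theorem corollary5p9 :
    Filter.Tendsto (fun n : ℕ => (1 / (n : ℝ)) * Real.log (MaxPooling.V n : ℝ)) Filter.atTop
        (nhds (Real.log MaxPooling.alpha2)) ∧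
      IsGreatest {x : ℝ | x ^ 3 - 11 * x ^ 2 + 9 * x - 2 = 0} MaxPooling.alpha2 ∧
      |MaxPooling.alpha2 - 10.1311| < 0.00005 ∧
      |Real.log MaxPooling.alpha2 - 2.3156| < 0.00005 := by
  have hroot := MaxPooling.isGreatest_alpha2.1
  have hI := MaxPooling.eigenvector_alpha2_mem_Icc
  obtain ⟨h1, h2⟩ := MaxPooling.alpha2_bounds
  refine ⟨?_, MaxPooling.isGreatest_alpha2, by rw [abs_lt]; constructor <;> linarith,
    MaxPooling.log_alpha2_bounds⟩
  have hα : 0 < MaxPooling.alpha2 := by linarith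
  refine (Filter.tendsto_add_atTop_iff_nat 1).1
    (MaxPooling.tendsto_log_div_of_pow_bounds (c := 1 / 20) (C := 20) hα (by norm_num) ?_ ?_)
  · intro m
    rw [MaxPooling.V_succ]
    have h := MaxPooling.le_acceptedCount hroot (fun s => (hI s).2) m .ll
    have := mul_le_mul_of_nonneg_left (hI .ll).1 (pow_nonneg hα.le m)
    linarith
  · intro m
    rw [MaxPooling.V_succ]
    have h := MaxPooling.acceptedCount_le hroot (fun s => (hI s).1) m .ll
    have := mul_le_mul_of_nonneg_left (hI .ll).2 (pow_nonneg hα.le m)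
    linarith
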